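/- **Setting.** An instance of the colorful $k$-center problem with two colors is a finite metric space $P$ partitioned into red points $R$ and blue points $B$, with integers $k,r,b\ge 0$. Write $\mathcal B(j,\rho)=\{i\in P: d(i,j)\le\rho\}$. The optimal radius of the instance is the least $\rho$ such that some set of at most $k$ points of $P$ has the property that the balls of radius $\rho$ around them cover at least $r$ points of $R$ and at least $b$ points of $B$. LP1 at radius $\rho$ has variables $x_i,z_j\in[0,1]$ ($i,j\in P$) and the constraints $$\sum_{i\in\mathcal B(j,\rho)}x_i\ge z_j\ (j\in P),\qquad \sum_{i\in P}x_i\le k,\qquad \sum_{j\in R}z_j\ge r,\qquad \sum_{j\in B}z_j\ge b .$$ For a finite set $V$ of variables and affine polynomials $g_\ell$ in them, with coefficients written $g_\ell=\sum_{J\subseteq V}a_{\ell,J}\prod_{v\in J}v$, let $\mathcal P_s(V)$ be the set of subsets of $V$ of size at most $s$. For $t\ge1$ the $t$-th Sum-of-Squares lifting of $\{x\in[0,1]^V: g_\ell(x)\ge0\ \forall\ell\}$ is the set of vectors $y\in[0,1]^{\mathcal P_{2t}(V)}$ such that $y_\emptyset=1$, the matrix $(y_{I\cup J})_{I,J\in\mathcal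 P_t(V)}$ is positive semidefinite, and, for every $\ell$, the matrix $\bigl((g_\ell*y)_{I\cup J}\bigr)_{I,J\in\mathcal P_{t-1}(V)}$ is positive semidefinite, where $(g_\ell*y)_I=\sum_{J\subseteq V}a_{\ell,J}\,y_{I\cup J}$. For $n$ odd and $D>1$, a gap instance with separation $D$ is an instance with $|P|=8n$, $k=n$, $r=b=2n$, in which $P$ is partitioned into clusters $C_1,\dots,C_{2n}$ of four points such that each $C_i$ contains a point at distance at most $1$ from all points of $C_i$, points of different clusters are at distance at least $D$, and $C_i$ has three red points and one blue point for $i$ odd, and one red point and three blue points for $i$ even. **Theorem** (the integrality gap of LP1 persists up to $\Omega(n)$ rounds of Sum-of-Squares). There is an absolute constant $c>0$ such that for every odd $n\ge 1$ and every $D>1$, gap instances with separation $D$ exist, and every such instance has the following two properties: 1. its optimal radius exists and is at least $D$; 2. for every integer $t$ with $1\le t\le cn$, the $t$-th Sum-of-Squares lifting of LP1 at radius one is non-empty. Since $D$ is arbitrary, the integrality gap of LP1 on instances with $8n$ points remains unbounded after $\lfloor cn\rfloor$ rounds of Sum-of-Squares, whenever $cn\ge 1$. -/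

import Mathlib

/-! ### The Sum-of-Squares lifting of a system of inequalities -/

section SumOfSquares

variable {V : Type*} [Fintype V] [DecidableEq V]

/-- The subsets of `V` of size at most `t`. -/
abbrev SubsetsUpTo (V : Type*) (t : ℕ) : Type _ := {I : Finset V // I.card ≤ t}

/-- The shift operator `(a * y)_I = ∑_J a_J y_{I ∪ J}`. A multilinear polynomial
`∑_J a_J ∏_{i ∈ J} x_i` is identified with its coefficient vector `a`. -/
def shiftOp (a y : Finset V → ℝ) : Finset V → ℝ :=
  fun I => ∑ J : Finset V, a J * y (I ∪ J)

/-- The moment matrix `(y_{I ∪ J})`, indexed by the subsets of size at most `t`. -/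
def momentMatrix (t : ℕ) (y : Finset V → ℝ) :
    Matrix (SubsetsUpTo V t) (SubsetsUpTo V t) ℝ :=
  Matrix.of fun I J => y (I.1 ∪ J.1)

/-- Extension by zero of a vector indexed by the subsets of size at most `s`. For affine `g` and
`1 ≤ t` the added entries are never read by the matrices in `sosLift`. -/
def extendByZero {s : ℕ} (y : SubsetsUpTo V s → ℝ) : Finset V → ℝ :=
  fun I => if h : I.card ≤ s then y ⟨I, h⟩ else 0

/-- The `t`-th SoS lifted polytope (`1 ≤ t`) of `{x ∈ [0,1]^V : g ℓ x ≥ 0 for all ℓ}`, where each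
`g ℓ` is the coefficient vector of an affine polynomial. -/
def sosLift {ι : Type*} (t : ℕ) (g : ι → Finset V → ℝ) : Set (SubsetsUpTo V (2 * t) → ℝ) :=
  {y | (∀ I, y I ∈ Set.Icc (0 : ℝ) 1) ∧
    extendByZero y ∅ = 1 ∧
    (momentMatrix t (extendByZero y)).PosSemidef ∧
    ∀ l, (momentMatrix (t - 1) (shiftOp (g l) (extendByZero y))).PosSemidef}

end SumOfSquares

/-! ### Colorful `k`-center with two colors, and its linear relaxation -/

/-- The data of an instance on the finite metric space `P`: a partition of the points into red and
blue ones, the number `k` of centers, and the numbers `r`, `b` of red and blue points to cover. -/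
structure ColorfulKCenter (P : Type*) [Fintype P] [DecidableEq P] where
  red : Finset P
  blue : Finset P
  isCompl : IsCompl red blue
  k : ℕ
  r : ℕ
  b : ℕ

open Classical in
/-- The set `B(j, ρ)` of all points at distance at most `ρ` from `j`. -/
noncomputable def pointBall {P : Type*} [Fintype P] [MetricSpace P] (j : P) (ρ : ℝ) : Finset P :=
  Finset.univ.filter fun i => dist i j ≤ ρ

/-- The labels of the inequalities of the relaxation. -/
inductive LP1Row (P : Type*) where
  | cover (j : P)
  | centers
  | redCoverage
  | blueCoverage

namespace ColorfulKCenter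

variable {P : Type*} [Fintype P] [DecidableEq P] [MetricSpace P]

/-- `k` balls of radius `ρ` centered at points of `P` can cover at least `r` red and at least `b`
blue points. -/
def CoverableWithRadius (I : ColorfulKCenter P) (ρ : ℝ) : Prop :=
  ∃ S : Finset P, S.card ≤ I.k ∧
    I.r ≤ ((S.biUnion fun s => pointBall s ρ) ∩ I.red).card ∧
    I.b ≤ ((S.biUnion fun s => pointBall s ρ) ∩ I.blue).card

/-- `ρ` is the optimal (integral) radius of the instance. -/
def IsOptimalRadius (I : ColorfulKCenter P) (ρ : ℝ) : Prop :=
  IsLeast {ρ' : ℝ | I.CoverableWithRadius ρ'} ρ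

/-- The inequalities of LP1 at radius `ρ`, written as `g ≥ 0`, where `g` is given by its
coefficients. The variable `x i` is `Sum.inl i`, the variable `z j` is `Sum.inr j`;
`Pi.single {v} 1` is the polynomial `v` and `Pi.single ∅ c` is the constant `c`.
* `cover j`: `∑_{i ∈ B(j, ρ)} x i - z j ≥ 0`;
* `centers`: `k - ∑_i x i ≥ 0`;
* `redCoverage`: `∑_{j red} z j - r ≥ 0`;
* `blueCoverage`: `∑_{j blue} z j - b ≥ 0`. -/
noncomputable def lp1 (I : ColorfulKCenter P) (ρ : ℝ) : LP1Row P → Finset (P ⊕ P) → ℝ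
  | .cover j => (∑ i ∈ pointBall j ρ, Pi.single {Sum.inl i} 1) - Pi.single {Sum.inr j} 1
  | .centers => Pi.single ∅ (I.k : ℝ) - ∑ i : P, Pi.single {Sum.inl i} 1
  | .redCoverage => (∑ j ∈ I.red, Pi.single {Sum.inr j} 1) - Pi.single ∅ (I.r : ℝ)
  | .blueCoverage => (∑ j ∈ I.blue, Pi.single {Sum.inr j} 1) - Pi.single ∅ (I.b : ℝ)

/-- The integrality gap instance with `8n` points in `2n` clusters of four points each, every
cluster lying in the unit ball around one of its points, different clusters being at distance at
least `D`. Clusters alternate between three red points and one blue point, and one red point and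
three blue points (the indices here start at `0`). -/
structure IsGapInstance (I : ColorfulKCenter P) (n : ℕ) (D : ℝ)
    (C : Fin (2 * n) → Finset P) : Prop where
  card_points : Fintype.card P = 8 * n
  k_eq : I.k = n
  r_eq : I.r = 2 * n
  b_eq : I.b = 2 * n
  partition : ∀ p : P, ∃! i, p ∈ C i
  radius_one : ∀ i, ∃ c ∈ C i, ∀ p ∈ C i, dist p c ≤ 1
  far_apart : ∀ i j, i ≠ j → ∀ p ∈ C i, ∀ q ∈ C j, D ≤ dist p q
  card_red : ∀ i, (C i ∩ I.red).card = if Even (i : ℕ) then 3 else 1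
  card_blue : ∀ i, (C i ∩ I.blue).card = if Even (i : ℕ) then 1 else 3

end ColorfulKCenter

/-! A ball of radius below `D` stays inside one cluster. If `p` even-indexed and `q` odd-indexed
clusters are touched, then `p + q ≤ n`, `3p + q ≥ 2n` and `p + 3q ≥ 2n` force `p = q = n/2`, which
is impossible for odd `n`.

Low-degree Sum-of-Squares does not see this parity obstruction. The lifted solution pretends to open
a uniformly random set of `n/2` clusters in each parity class, independently: its moments are the
hypergeometric formula evaluated at the non-integral value `κ = n/2`, multiplied over the two
classes (`splitMoment`) and pulled back to the points (`clusterMoment`). Every constraint then holds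
with equality even after multiplication by monomials, so the constraint matrices vanish and only the
moment matrix must be shown positive semidefinite.

This is `exists_gram_hypergeomMoment`. The relation `∑ x = κ` reduces all monomials to degree
exactly `t`. For `|T| = |T'| = t`, summing out the pattern on `T ∩ T'` writes the moment of `T ∪ T'`
as a sum over `K ⊆ T ∩ T'` of weights depending only on `|K|`. These weights are nonnegative when
`2t ≤ κ` and `t ≤ |U| - κ`, which leads to `t ≤ n/4`. -/

/-! ### Hypergeometric pseudo-moments -/

/-- The value `(κ)_a (n - κ)_b / (n)_{a + b}`, with falling factorials: for integral `κ` this is the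
probability that a uniformly random `κ`-element subset of an `n`-element set contains `a` given
elements and avoids `b` further given elements. -/
noncomputable def hypergeomMoment (κ n : ℝ) (a b : ℕ) : ℝ :=
  (∏ j ∈ Finset.range a, (κ - j)) * (∏ j ∈ Finset.range b, (n - κ - j)) /
    ∏ j ∈ Finset.range (a + b), (n - j)

lemma hypergeomMoment_zero_zero (κ n : ℝ) : hypergeomMoment κ n 0 0 = 1 := by
  simp [hypergeomMoment]

lemma hypergeomMoment_succ_left {κ n : ℝ} {a : ℕ} (h : (a : ℝ) < n) :
    (n - a) * hypergeomMoment κ n (a + 1) 0 = (κ - a) * hypergeomMoment κ n a 0 := by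
  have h' : n - a ≠ 0 := by linarith
  simp only [hypergeomMoment, Finset.prod_range_succ, add_zero, Finset.range_zero,
    Finset.prod_empty, mul_one]
  rw [mul_div_mul_comm]
  field_simp

lemma hypergeomMoment_split {κ n : ℝ} {a b : ℕ} (h : (a + b : ℝ) < n) :
    hypergeomMoment κ n a b = hypergeomMoment κ n (a + 1) b + hypergeomMoment κ n a (b + 1) := by
  have h' : n - (a + b) ≠ 0 := by linarith
  simp only [hypergeomMoment]
  rw [show a + 1 + b = a + b + 1 by ring, ← add_assoc, ← add_div]
  simp only [Finset.prod_range_succ]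
  push_cast
  rw [show (∏ j ∈ Finset.range a, (κ - j)) * (κ - a) * (∏ j ∈ Finset.range b, (n - κ - j)) +
      (∏ j ∈ Finset.range a, (κ - j)) * ((∏ j ∈ Finset.range b, (n - κ - j)) * (n - κ - b)) =
      (∏ j ∈ Finset.range a, (κ - j)) * (∏ j ∈ Finset.range b, (n - κ - j)) * (n - (a + b)) by ring,
    mul_div_mul_right _ _ h']

lemma hypergeomMoment_nonneg {κ n : ℝ} {a b : ℕ} (ha : (a : ℝ) ≤ κ) (hb : (b : ℝ) ≤ n - κ) :
    0 ≤ hypergeomMoment κ n a b := by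
  have key : ∀ (x : ℝ) (m : ℕ), (m : ℝ) ≤ x → 0 ≤ ∏ j ∈ Finset.range m, (x - j) := by
    intro x m hm
    refine Finset.prod_nonneg fun j hj => ?_
    have : (j : ℝ) < m := by exact_mod_cast Finset.mem_range.1 hj
    linarith
  exact div_nonneg (mul_nonneg (key _ _ ha) (key _ _ hb)) (key _ _ (by push_cast; linarith))

lemma hypergeomMoment_le_one {κ n : ℝ} {a : ℕ} (ha : (a : ℝ) ≤ κ) (hκ : κ ≤ n) :
    hypergeomMoment κ n a 0 ≤ 1 := by
  simp only [hypergeomMoment, Finset.range_zero, Finset.prod_empty, mul_one, add_zero]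
  have hlt : ∀ j ∈ Finset.range a, (j : ℝ) < κ := fun j hj =>
    lt_of_lt_of_le (by exact_mod_cast Finset.mem_range.1 hj) ha
  refine div_le_one_of_le₀ (Finset.prod_le_prod (fun j hj => ?_) fun j _ => ?_)
    (Finset.prod_nonneg fun j hj => ?_)
  · linarith [hlt j hj]
  · linarith
  · linarith [hlt j hj]

/-! ### Positive semidefiniteness of the hypergeometric moment matrix. -/

section Gram

variable {A : Type*} [DecidableEq A]

/-- Repeated splitting: the pattern on the elements of `M` is summed out. -/
lemma hypergeomMoment_eq_sum_powerset {κ n : ℝ} (M : Finset A) :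
    ∀ a b : ℕ, (a + b + M.card : ℝ) ≤ n →
      hypergeomMoment κ n a b =
        ∑ K ∈ M.powerset, hypergeomMoment κ n (a + M.card - K.card) (b + K.card) := by
  induction M using Finset.induction_on with
  | empty => intro a b _; simp
  | insert x M hx ih =>
    intro a b h
    rw [Finset.card_insert_of_notMem hx] at h ⊢
    push_cast at h
    rw [Finset.sum_powerset_insert hx, hypergeomMoment_split (by
      have : (0 : ℝ) ≤ M.card := Nat.cast_nonneg _
      linarith), ih (a + 1) b (by push_cast; linarith), ih a (b + 1) (by push_cast; linarith)]
    congr 1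
    · exact Finset.sum_congr rfl fun K _ => by congr 2; omega
    · refine Finset.sum_congr rfl fun K hK => ?_
      rw [Finset.card_insert_of_notMem fun h => hx (Finset.mem_powerset.1 hK h)]
      congr 1 <;> omega

/-- The pseudo-moments respect the constraint `∑ x = κ`. -/
lemma sum_hypergeomMoment_insert {κ : ℝ} {U S : Finset A} (hS : S ⊆ U) (h : S.card < U.card) :
    ∑ a ∈ U, hypergeomMoment κ U.card (insert a S).card 0 =
      κ * hypergeomMoment κ U.card S.card 0 := by
  rw [← Finset.sum_sdiff hS]
  have h₁ : ∑ a ∈ U \ S, hypergeomMoment κ U.card (insert a S).card 0 =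
      ((U.card : ℝ) - S.card) * hypergeomMoment κ U.card (S.card + 1) 0 := by
    rw [Finset.sum_congr rfl fun a ha => by
      rw [Finset.card_insert_of_notMem (Finset.mem_sdiff.1 ha).2], Finset.sum_const,
      Finset.card_sdiff_of_subset hS, nsmul_eq_mul, Nat.cast_sub h.le]
  have h₂ : ∑ a ∈ S, hypergeomMoment κ U.card (insert a S).card 0 =
      S.card * hypergeomMoment κ U.card S.card 0 := by
    rw [Finset.sum_congr rfl fun a ha => by rw [Finset.insert_eq_of_mem ha], Finset.sum_const,
      nsmul_eq_mul]
  rw [h₁, h₂, hypergeomMoment_succ_left (by exact_mod_cast h)]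
  ring

/-- Modulo `∑ x = κ`, monomials of degree at most `t` are combinations of monomials of
degree exactly `t`. -/
lemma exists_homogenization {κ : ℝ} {U : Finset A} {t : ℕ} (ht : (2 * t : ℝ) ≤ κ)
    (hκ : κ ≤ U.card) (d : ℕ) :
    ∀ I ⊆ U, I.card + d = t → ∃ φ : Finset A → ℝ, ∀ J ⊆ U, J.card ≤ t →
      hypergeomMoment κ U.card (I ∪ J).card 0 =
        ∑ T ∈ U.powersetCard t, φ T * hypergeomMoment κ U.card (T ∪ J).card 0 := by
  induction d with
  | zero =>
    intro I hI hd
    refine ⟨fun T => if T = I then 1 else 0, fun J _ _ => ?_⟩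
    simp only [ite_mul, one_mul, zero_mul]
    rw [Finset.sum_ite_eq', if_pos (Finset.mem_powersetCard.2 ⟨hI, by omega⟩)]
  | succ d ih =>
    intro I hI hd
    have hex : ∀ a : A, ∃ φ : Finset A → ℝ, a ∈ U \ I → ∀ J ⊆ U, J.card ≤ t →
        hypergeomMoment κ U.card (insert a I ∪ J).card 0 =
          ∑ T ∈ U.powersetCard t, φ T * hypergeomMoment κ U.card (T ∪ J).card 0 := by
      intro a
      by_cases ha : a ∈ U \ I
      · obtain ⟨haU, haI⟩ := Finset.mem_sdiff.1 ha
        obtain ⟨φ, hφ⟩ := ih (insert a I) (Finset.insert_subset haU hI)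
          (by rw [Finset.card_insert_of_notMem haI]; omega)
        exact ⟨φ, fun _ => hφ⟩
      -- Junk value, present only so that `choose` yields a total function.
      · exact ⟨0, fun h => absurd h ha⟩
    choose φ hφ using hex
    -- Since `x_a x_I = x_I` for `a ∈ I`, the relation `∑ x = κ` gives `(κ - |I|) x_I = ∑ x_{I ∪
    -- {a}}` over `a ∉ I`; divide by `κ - |I|`.
    refine ⟨fun T => (κ - I.card)⁻¹ * ∑ a ∈ U \ I, φ a T, fun J hJ hJt => ?_⟩
    have hIt : (I.card : ℝ) + 1 ≤ t := by exact_mod_cast (by omega : I.card + 1 ≤ t)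
    have hne : κ - I.card ≠ 0 := by
      have : (0 : ℝ) ≤ t := Nat.cast_nonneg _
      intro h
      have : κ = I.card := by linarith
      linarith
    have hcard : (I ∪ J).card < U.card := by
      have h₁ := Finset.card_union_le I J
      have h₂ : 2 * t ≤ U.card := by exact_mod_cast ht.trans hκ
      omega
    have hsum := sum_hypergeomMoment_insert (κ := κ) (Finset.union_subset hI hJ) hcard
    rw [← Finset.sum_sdiff hI, Finset.sum_congr (s₁ := I) rfl fun a ha => by
      rw [Finset.insert_eq_of_mem (Finset.mem_union_left J ha)], Finset.sum_const, nsmul_eq_mul,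
      ← eq_sub_iff_add_eq, ← sub_mul] at hsum
    rw [← mul_right_inj' hne, ← hsum, Finset.sum_congr rfl fun a ha => by
      rw [← Finset.insert_union, hφ a ha J hJ hJt], Finset.sum_comm, Finset.mul_sum]
    refine Finset.sum_congr rfl fun T _ => ?_
    rw [← Finset.sum_mul, ← mul_assoc, ← mul_assoc, mul_inv_cancel₀ hne, one_mul]

/-- The moment matrix of the pseudo-moments is a Gram matrix. -/
lemma exists_gram_hypergeomMoment {κ : ℝ} {U : Finset A} {t : ℕ} (ht : (2 * t : ℝ) ≤ κ)
    (hκ : κ + t ≤ U.card) :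
    ∃ ψ : Finset A → Finset A → ℝ, ∀ I ⊆ U, ∀ J ⊆ U, I.card ≤ t → J.card ≤ t →
      hypergeomMoment κ U.card (I ∪ J).card 0 = ∑ K ∈ U.powerset, ψ I K * ψ J K := by
  have ht₀ : (0 : ℝ) ≤ t := Nat.cast_nonneg _
  have hex : ∀ I : Finset A, ∃ φ : Finset A → ℝ, I ⊆ U → I.card ≤ t → ∀ J ⊆ U, J.card ≤ t →
      hypergeomMoment κ U.card (I ∪ J).card 0 =
        ∑ T ∈ U.powersetCard t, φ T * hypergeomMoment κ U.card (T ∪ J).card 0 := by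
    intro I
    by_cases hI : I ⊆ U ∧ I.card ≤ t
    · obtain ⟨φ, hφ⟩ := exists_homogenization ht (by linarith) (t - I.card) I hI.1 (by omega)
      exact ⟨φ, fun _ _ => hφ⟩
    · exact ⟨0, fun h h' => absurd ⟨h, h'⟩ hI⟩
  choose φ hφ using hex
  have hnonneg : ∀ K : Finset A, K.card ≤ t →
      0 ≤ hypergeomMoment κ U.card (2 * t - K.card) K.card := by
    intro K hK
    have hK' : (K.card : ℝ) ≤ t := by exact_mod_cast hK
    refine hypergeomMoment_nonneg ?_ (by linarith)
    refine le_trans ?_ ht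
    exact_mod_cast Nat.sub_le _ _
  have htop : ∀ T ∈ U.powersetCard t, ∀ T' ∈ U.powersetCard t,
      hypergeomMoment κ U.card (T ∪ T').card 0 = ∑ K ∈ U.powerset,
        (if K ⊆ T then √(hypergeomMoment κ U.card (2 * t - K.card) K.card) else 0) *
        (if K ⊆ T' then √(hypergeomMoment κ U.card (2 * t - K.card) K.card) else 0) := by
    intro T hT T' hT'
    obtain ⟨hTU, hTt⟩ := Finset.mem_powersetCard.1 hT
    obtain ⟨hTU', hTt'⟩ := Finset.mem_powersetCard.1 hT'
    have hcard := Finset.card_union_add_card_inter T T'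
    -- As `|T ∪ T'| + |T ∩ T'| = 2t`, the summand for `K` depends on `T` and `T'` only through the
    -- condition `K ⊆ T ∩ T'`, which factors.
    rw [hypergeomMoment_eq_sum_powerset (T ∩ T') _ _ (by
      have : (((T ∪ T').card + (T ∩ T').card : ℕ) : ℝ) = 2 * t := by
        rw [hcard, hTt, hTt']; push_cast; ring
      push_cast at this ⊢
      linarith)]
    refine Finset.sum_subset_zero_on_sdiff ?_ ?_ ?_
    · exact Finset.powerset_mono.2 (Finset.inter_subset_left.trans hTU)
    · intro K hK
      have := (Finset.mem_sdiff.1 hK).2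
      rw [Finset.mem_powerset, Finset.subset_inter_iff, not_and_or] at this
      rcases this with h | h <;> simp [h]
    · intro K hK
      obtain ⟨h₁, h₂⟩ := Finset.subset_inter_iff.1 (Finset.mem_powerset.1 hK)
      rw [if_pos h₁, if_pos h₂, Real.mul_self_sqrt (hnonneg K (hTt ▸ Finset.card_le_card h₁))]
      congr 1 <;> omega
  refine ⟨fun I K => ∑ T ∈ U.powersetCard t, φ I T *
    (if K ⊆ T then √(hypergeomMoment κ U.card (2 * t - K.card) K.card) else 0),
    fun I hI J hJ hIt hJt => ?_⟩
  have hexpand : hypergeomMoment κ U.card (I ∪ J).card 0 = ∑ T ∈ U.powersetCard t,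
      ∑ T' ∈ U.powersetCard t, φ I T * φ J T' * hypergeomMoment κ U.card (T ∪ T').card 0 := by
    rw [hφ I hI hIt J hJ hJt]
    refine Finset.sum_congr rfl fun T hT => ?_
    obtain ⟨hTU, hTt⟩ := Finset.mem_powersetCard.1 hT
    rw [Finset.union_comm, hφ J hJ hJt T hTU hTt.le, Finset.mul_sum]
    exact Finset.sum_congr rfl fun T' _ => by rw [Finset.union_comm T' T, mul_assoc]
  rw [hexpand]
  simp only [Finset.sum_mul_sum]
  conv_rhs => rw [Finset.sum_comm]
  refine Finset.sum_congr rfl fun T hT => ?_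
  rw [Finset.sum_comm]
  refine Finset.sum_congr rfl fun T' hT' => ?_
  rw [htop T hT T' hT', Finset.mul_sum]
  exact Finset.sum_congr rfl fun K _ => by ring

end Gram

/-! ### Gap instances exist -/

/-- The metric with distance `1` inside the fibers of `cl` and distance `D` between them. -/
noncomputable abbrev clusterMetric {P ι : Type*} [DecidableEq P] [DecidableEq ι] (cl : P → ι)
    (D : ℝ) (hD : 1 < D) : MetricSpace P where
  dist p q := if p = q then 0 else if cl p = cl q then 1 else D
  dist_self p := by simp
  dist_comm p q := by simp only [eq_comm]
  dist_triangle p q s := by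
    by_cases hpq : p = q
    · subst hpq; simp
    by_cases hqs : q = s
    · subst hqs; simp
    by_cases hps : p = s
    · simp only [hqs, hps, if_true, if_false]
      split_ifs <;> linarith
    simp only [hpq, hqs, hps, if_false]
    -- The only case that is not arithmetic, `D ≤ 1 + 1`, is excluded by transitivity of lying in
    -- the same cluster.
    split_ifs with h₁ h₂ h₃ h₃ h₂ h₃ h₃ <;> first | linarith | exact absurd (h₂.trans h₃) h₁
  eq_of_dist_eq_zero {p q} h := by
    by_contra hpq
    simp only [hpq, if_false] at h
    split_ifs at h <;> linarith

namespace ColorfulKCenter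

lemma exists_isGapInstance (n : ℕ) {D : ℝ} (hD : 1 < D) :
    ∃ (P : Type) (_ : Fintype P) (_ : DecidableEq P) (_ : MetricSpace P)
      (I : ColorfulKCenter P) (C : Fin (2 * n) → Finset P), I.IsGapInstance n D C := by
  let red : Finset (Fin (2 * n) × Fin 4) :=
    Finset.univ.filter fun p => if Even (p.1 : ℕ) then p.2 ≠ 0 else p.2 = 0
  let C : Fin (2 * n) → Finset (Fin (2 * n) × Fin 4) := fun i => {i} ×ˢ Finset.univ
  have hmem : ∀ p i, p ∈ C i ↔ p.1 = i := fun p i => by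
    simp only [C, Finset.mem_product, Finset.mem_singleton, Finset.mem_univ, and_true]
  have hC : ∀ (i : Fin (2 * n)) (Q : Finset (Fin (2 * n) × Fin 4)),
      (C i ∩ Q).card = (Finset.univ.filter fun q : Fin 4 => (i, q) ∈ Q).card := by
    intro i Q
    rw [← Finset.card_map (Function.Embedding.sectR i (Fin 4))]
    congr 1
    ext ⟨j, q⟩
    simp only [C, Finset.mem_inter, Finset.mem_product, Finset.mem_singleton, Finset.mem_univ,
      and_true, Finset.mem_map, Finset.mem_filter, true_and, Function.Embedding.sectR_apply,
      Prod.mk.injEq]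
    constructor
    · rintro ⟨rfl, h⟩; exact ⟨q, h, rfl, rfl⟩
    · rintro ⟨q, h, rfl, rfl⟩; exact ⟨rfl, h⟩
  let _ : MetricSpace (Fin (2 * n) × Fin 4) := clusterMetric Prod.fst D hD
  refine ⟨Fin (2 * n) × Fin 4, inferInstance, inferInstance, inferInstance,
    ⟨red, redᶜ, isCompl_compl, n, 2 * n, 2 * n⟩, C, ?_⟩
  refine
    { card_points := by simp; ring
      k_eq := rfl
      r_eq := rfl
      b_eq := rfl
      partition := fun p => ⟨p.1, (hmem p p.1).2 rfl, fun i hi => ((hmem p i).1 hi).symm⟩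
      radius_one := fun i => ⟨(i, 0), (hmem _ _).2 rfl, fun p hp => ?_⟩
      far_apart := fun i j hij p hp q hq => ?_
      card_red := fun i => ?_
      card_blue := fun i => ?_ }
  · change (if p = (i, 0) then (0 : ℝ) else if p.1 = i then 1 else D) ≤ 1
    have : p.1 = i := (hmem _ _).1 hp
    rw [if_pos this]
    split_ifs <;> norm_num
  · change D ≤ if p = q then (0 : ℝ) else if p.1 = q.1 then 1 else D
    have hp : p.1 = i := (hmem _ _).1 hp
    have hq : q.1 = j := (hmem _ _).1 hq
    have hne : p.1 ≠ q.1 := by rw [hp, hq]; exact hij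
    rw [if_neg fun h => hne (congrArg _ h), if_neg hne]
  · rw [hC]
    by_cases hi : Even (i : ℕ)
    · simp only [red, hi, Finset.mem_filter, Finset.mem_univ, if_true, true_and]; decide
    · simp only [red, hi, Finset.mem_filter, Finset.mem_univ, if_false, true_and]; decide
  · rw [hC]
    by_cases hi : Even (i : ℕ)
    · simp only [red, hi, Finset.mem_compl, Finset.mem_filter, Finset.mem_univ, if_true, true_and]
      decide
    · simp only [red, hi, Finset.mem_compl, Finset.mem_filter, Finset.mem_univ, if_false, true_and]
      decide

/-! ### The integral optimum of a gap instance -/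

lemma sum_eq_sum_clusters {P ι : Type*} [DecidableEq P] [Fintype ι] [DecidableEq ι]
    {C : ι → Finset P}
    {cl : P → ι} (hcl : ∀ p i, p ∈ C i ↔ cl p = i) (Q : Finset P) (F : ι → ℝ) :
    ∑ j ∈ Q, F (cl j) = ∑ i, ((C i ∩ Q).card : ℝ) * F i := by
  rw [← Finset.sum_fiberwise Q cl]
  refine Finset.sum_congr rfl fun i _ => ?_
  rw [Finset.sum_congr rfl fun j hj => by rw [(Finset.mem_filter.1 hj).2], Finset.sum_const,
    nsmul_eq_mul]
  congr 3
  ext p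
  simp [hcl, and_comm]

/-! ### Existence of the optimal radius. -/

section

variable {P : Type*} [Fintype P] [MetricSpace P]

lemma mem_pointBall {i j : P} {ρ : ℝ} : i ∈ pointBall j ρ ↔ dist i j ≤ ρ := by
  simp [pointBall]

/-- Balls change only at the finitely many realized distances, so a radius can be lowered to the
largest such distance not exceeding it. -/
lemma exists_dist_le_pointBall_eq [Nonempty P] {ρ : ℝ} (hρ : 0 ≤ ρ) :
    ∃ q : P × P, dist q.1 q.2 ≤ ρ ∧ ∀ s : P, pointBall s ρ = pointBall s (dist q.1 q.2) := by
  classical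
  let p : P := Classical.arbitrary P
  obtain ⟨q, hq, hmax⟩ := Finset.exists_max_image
    (Finset.univ.filter fun q : P × P => dist q.1 q.2 ≤ ρ) (fun q => dist q.1 q.2)
    ⟨(p, p), by simpa using hρ⟩
  rw [Finset.mem_filter] at hq
  refine ⟨q, hq.2, fun s => ?_⟩
  ext i
  rw [mem_pointBall, mem_pointBall]
  exact ⟨fun h => hmax (i, s) (by simpa using h), fun h => h.trans hq.2⟩

variable [DecidableEq P] {I : ColorfulKCenter P}

/-- It suffices to minimize over the finitely many realized distances. Positivity of `I.r` yields a
covered point and hence `ρ ≥ 0`; otherwise negative radii could be feasible and no least one need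
exist. -/
lemma exists_isOptimalRadius (hr : 0 < I.r) {ρ₀ : ℝ} (h₀ : I.CoverableWithRadius ρ₀) :
    ∃ ρ, I.IsOptimalRadius ρ := by
  classical
  have hred : ∀ ρ, I.CoverableWithRadius ρ →
      ∃ q : P × P, dist q.1 q.2 ≤ ρ ∧ I.CoverableWithRadius (dist q.1 q.2) := by
    rintro ρ ⟨S, hS, hSr, hSb⟩
    obtain ⟨p, hp⟩ := Finset.card_pos.1 (hr.trans_le hSr)
    obtain ⟨s, -, hps⟩ := Finset.mem_biUnion.1 (Finset.mem_inter.1 hp).1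
    have : Nonempty P := ⟨p⟩
    obtain ⟨q, hq, hball⟩ :=
      exists_dist_le_pointBall_eq (P := P) (dist_nonneg.trans (mem_pointBall.1 hps))
    refine ⟨q, hq, S, hS, ?_, ?_⟩ <;> simpa only [← hball]
  obtain ⟨q₀, -, hq₀⟩ := hred ρ₀ h₀
  obtain ⟨q, hq, hmin⟩ := Finset.exists_min_image
    (Finset.univ.filter fun q : P × P => I.CoverableWithRadius (dist q.1 q.2))
    (fun q => dist q.1 q.2) ⟨q₀, by simpa using hq₀⟩
  refine ⟨dist q.1 q.2, (Finset.mem_filter.1 hq).2, fun ρ hρ => ?_⟩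
  obtain ⟨q', hq', hcov⟩ := hred ρ hρ
  exact (hmin q' (by simpa using hcov)).trans hq'

end

/-! ### The parity obstruction and a lower bound on the optimum. -/

namespace IsGapInstance

variable {P : Type*} [Fintype P] [DecidableEq P] [MetricSpace P] {I : ColorfulKCenter P} {n : ℕ}
  {D : ℝ} {C : Fin (2 * n) → Finset P}

lemma exists_cluster (h : I.IsGapInstance n D C) :
    ∃ cl : P → Fin (2 * n), ∀ p i, p ∈ C i ↔ cl p = i := by
  choose cl hcl huniq using h.partition
  exact ⟨cl, fun p i => ⟨fun hp => (huniq p i hp).symm, fun hp => hp ▸ hcl p⟩⟩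

lemma not_coverableWithRadius (h : I.IsGapInstance n D C) (hn : Odd n) {ρ : ℝ} (hρ : ρ < D) :
    ¬ I.CoverableWithRadius ρ := by
  obtain ⟨cl, hcl⟩ := h.exists_cluster
  rintro ⟨S, hS, hSr, hSb⟩
  have hsub : ∀ Q : Finset P, ((S.biUnion fun s => pointBall s ρ) ∩ Q).card ≤
      ∑ i ∈ S.image cl, (C i ∩ Q).card := by
    intro Q
    refine le_trans (Finset.card_le_card fun p hp => ?_) Finset.card_biUnion_le
    obtain ⟨hp, hpQ⟩ := Finset.mem_inter.1 hp
    obtain ⟨s, hs, hps⟩ := Finset.mem_biUnion.1 hp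
    refine Finset.mem_biUnion.2 ⟨cl s, Finset.mem_image_of_mem _ hs,
      Finset.mem_inter.2 ⟨(hcl _ _).2 ?_, hpQ⟩⟩
    by_contra hne
    have := h.far_apart _ _ hne p ((hcl _ _).2 rfl) s ((hcl _ _).2 rfl)
    linarith [mem_pointBall.1 hps]
  have hr := hSr.trans (hsub I.red)
  have hb := hSb.trans (hsub I.blue)
  simp only [h.card_red, h.card_blue, h.r_eq, h.b_eq, Finset.sum_ite, Finset.sum_const,
    smul_eq_mul] at hr hb
  have hk : (S.image cl).card ≤ n := Finset.card_image_le.trans (h.k_eq ▸ hS)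
  have hsplit := Finset.card_filter_add_card_filter_not (s := S.image cl)
    fun i : Fin (2 * n) => Even (i : ℕ)
  -- With `p` even-indexed and `q` odd-indexed clusters, adding the two coverage bounds gives `p + q
  -- = n`; each then gives `2p ≥ n` or `2q ≥ n`, so `2p = n`, against oddness.
  obtain ⟨m, rfl⟩ := hn
  omega

lemma card_filter_even : (Finset.univ.filter fun i : Fin (2 * n) => Even (i : ℕ)).card = n := by
  have key : ∀ m : ℕ, ∑ i ∈ Finset.range (2 * m), (if Even i then 1 else 0) = m := by
    intro m
    induction m with
    | zero => rfl
    | succ m ih =>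
      rw [show 2 * (m + 1) = 2 * m + 1 + 1 by ring, Finset.sum_range_succ, Finset.sum_range_succ,
        ih, if_pos (even_two_mul m), if_neg (by simp)]
  rw [Finset.card_filter, Fin.sum_univ_eq_sum_range fun i => if Even i then 1 else 0, key]

lemma card_filter_not_even :
    (Finset.univ.filter fun i : Fin (2 * n) => ¬ Even (i : ℕ)).card = n := by
  have := Finset.card_filter_add_card_filter_not (s := Finset.univ)
    fun i : Fin (2 * n) => Even (i : ℕ)
  rw [card_filter_even, Finset.card_univ, Fintype.card_fin] at this
  omega

lemma card_eq_sum (h : I.IsGapInstance n D C) (Q : Finset P) : Q.card = ∑ i, (C i ∩ Q).card := by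
  obtain ⟨cl, hcl⟩ := h.exists_cluster
  have := sum_eq_sum_clusters hcl Q fun _ => 1
  simp only [Finset.sum_const, nsmul_eq_mul, mul_one] at this
  exact_mod_cast this

lemma exists_coverableWithRadius (h : I.IsGapInstance n D C) (hn : 0 < n) :
    ∃ ρ, I.CoverableWithRadius ρ := by
  have hred : I.red.card = 4 * n := by
    rw [h.card_eq_sum]
    simp only [h.card_red, Finset.sum_ite, Finset.sum_const, card_filter_even,
      card_filter_not_even, smul_eq_mul]
    ring
  have hblue : I.blue.card = 4 * n := by
    rw [h.card_eq_sum]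
    simp only [h.card_blue, Finset.sum_ite, Finset.sum_const, card_filter_even,
      card_filter_not_even, smul_eq_mul]
    ring
  -- A single ball containing all of `P` is feasible.
  obtain ⟨p, -⟩ := h.radius_one ⟨0, by omega⟩
  obtain ⟨ρ, hρ⟩ := (Set.finite_range fun q : P => dist q p).bddAbove
  have hball : pointBall p ρ = Finset.univ :=
    Finset.eq_univ_of_forall fun q => mem_pointBall.2 (hρ ⟨q, rfl⟩)
  refine ⟨ρ, {p}, ?_, ?_, ?_⟩
  · rw [h.k_eq, Finset.card_singleton]; omega
  · rw [Finset.singleton_biUnion, hball, Finset.univ_inter, hred, h.r_eq]; omega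
  · rw [Finset.singleton_biUnion, hball, Finset.univ_inter, hblue, h.b_eq]; omega

lemma exists_isOptimalRadius_ge (h : I.IsGapInstance n D C) (hn : Odd n) :
    ∃ ρ : ℝ, I.IsOptimalRadius ρ ∧ D ≤ ρ := by
  obtain ⟨ρ₀, h₀⟩ := h.exists_coverableWithRadius hn.pos
  obtain ⟨ρ, hρ⟩ := exists_isOptimalRadius (by rw [h.r_eq]; have := hn.pos; omega) h₀
  exact ⟨ρ, hρ, not_lt.1 fun hlt => h.not_coverableWithRadius hn hlt hρ.1⟩

end IsGapInstance

end ColorfulKCenter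

/-! ### The lifted solution -/

lemma extendByZero_of_card_le {V : Type*} {s : ℕ} (y : Finset V → ℝ) {I : Finset V} (hI : I.card ≤ s) :
    extendByZero (fun J : SubsetsUpTo V s => y J.1) I = y I := by
  simp [extendByZero, hI]

section ShiftOp

variable {V : Type*} [Fintype V] [DecidableEq V]

lemma shiftOp_single (J : Finset V) (c : ℝ) (y : Finset V → ℝ) (I : Finset V) :
    shiftOp (Pi.single J c) y I = c * y (I ∪ J) := by
  rw [shiftOp, Finset.sum_eq_single J]
  · simp
  · intro K _ hK; simp [Pi.single_eq_of_ne hK]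
  · simp

lemma shiftOp_sub (a b y : Finset V → ℝ) (I : Finset V) :
    shiftOp (a - b) y I = shiftOp a y I - shiftOp b y I := by
  simp [shiftOp, sub_mul]

lemma shiftOp_sum {α : Type*} (s : Finset α) (a : α → Finset V → ℝ) (y : Finset V → ℝ)
    (I : Finset V) : shiftOp (∑ i ∈ s, a i) y I = ∑ i ∈ s, shiftOp (a i) y I := by
  simp only [shiftOp, Finset.sum_apply, Finset.sum_mul]
  exact Finset.sum_comm

/-- A vector of moments given by a Gram representation, and satisfying all inequalities with
equality after multiplication by monomials, lies in the lifting. -/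
lemma mem_sosLift_of_gram {ι κ : Type*} (S : Finset κ) {t : ℕ} (ht : 1 ≤ t)
    {g : ι → Finset V → ℝ} {y : Finset V → ℝ} (hy : ∀ I, I.card ≤ 2 * t → y I ∈ Set.Icc (0 : ℝ) 1)
    (hempty : y ∅ = 1) (ψ : Finset V → κ → ℝ)
    (hψ : ∀ I J, I.card ≤ t → J.card ≤ t → y (I ∪ J) = ∑ K ∈ S, ψ I K * ψ J K)
    (hg : ∀ l I, I.card + 2 ≤ 2 * t →
      shiftOp (g l) (extendByZero fun J : SubsetsUpTo V (2 * t) => y J.1) I = 0) :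
    (fun J : SubsetsUpTo V (2 * t) => y J.1) ∈ sosLift t g := by
  refine ⟨fun I => hy I.1 I.2, ?_, ?_, fun l => ?_⟩
  · rw [extendByZero_of_card_le _ (by simp), hempty]
  · have : momentMatrix t (extendByZero fun J : SubsetsUpTo V (2 * t) => y J.1) =
        Matrix.conjTranspose (Matrix.of fun (K : S) (I : SubsetsUpTo V t) => ψ I.1 K.1) *
          Matrix.of fun (K : S) (I : SubsetsUpTo V t) => ψ I.1 K.1 := by
      ext I J
      have hc := Finset.card_union_le I.1 J.1
      have hI := I.2
      have hJ := J.2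
      rw [momentMatrix, Matrix.of_apply, extendByZero_of_card_le _ (by omega), hψ _ _ hI hJ,
        Matrix.mul_apply, ← Finset.sum_coe_sort]
      simp
    rw [this]
    exact Matrix.posSemidef_conjTranspose_mul_self _
  · have : momentMatrix (t - 1)
        (shiftOp (g l) (extendByZero fun J : SubsetsUpTo V (2 * t) => y J.1)) = 0 := by
      ext I J
      have hc := Finset.card_union_le I.1 J.1
      have hI := I.2
      have hJ := J.2
      rw [momentMatrix, Matrix.of_apply, hg _ _ (by omega), Matrix.zero_apply]
    rw [this]
    exact Matrix.PosSemidef.zero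

end ShiftOp

/-! ### Independent product of the two parity classes. -/

section SplitMoment

variable {A : Type*} (E : A → Prop) [DecidablePred E]

/-- The product of the pseudo-moments on `{a | E a}` and on its complement, each of them thought
of as having `n` elements `n / 2` of which are chosen. -/
noncomputable def splitMoment (n : ℕ) (S : Finset A) : ℝ :=
  hypergeomMoment (n / 2) n (S.filter E).card 0 *
    hypergeomMoment (n / 2) n (S.filter fun a => ¬ E a).card 0

variable {E} {n : ℕ}

lemma splitMoment_not (S : Finset A) :
    splitMoment (fun a => ¬ E a) n S = splitMoment E n S := by
  simp only [splitMoment, not_not]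
  exact mul_comm _ _

lemma splitMoment_mem_Icc {S : Finset A} (hS : (S.card : ℝ) ≤ n / 2) :
    splitMoment E n S ∈ Set.Icc (0 : ℝ) 1 := by
  have hn : (0 : ℝ) ≤ n := Nat.cast_nonneg _
  have hle : ∀ (q : A → Prop) [DecidablePred q], ((S.filter q).card : ℝ) ≤ n / 2 := fun q _ =>
    le_trans (by exact_mod_cast Finset.card_filter_le _ _) hS
  have h₀ : ∀ (q : A → Prop) [DecidablePred q],
      0 ≤ hypergeomMoment (n / 2) n (S.filter q).card 0 := fun q _ =>
    hypergeomMoment_nonneg (hle q) (by push_cast; linarith)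
  exact ⟨mul_nonneg (h₀ _) (h₀ _), mul_le_one₀ (hypergeomMoment_le_one (hle _) (by linarith))
    (h₀ _) (hypergeomMoment_le_one (hle _) (by linarith))⟩

variable [Fintype A] [DecidableEq A]

lemma sum_splitMoment_insert (hE : (Finset.univ.filter E).card = n) {S : Finset A}
    (hS : S.card < n) :
    ∑ a ∈ Finset.univ.filter E, splitMoment E n (insert a S) = n / 2 * splitMoment E n S := by
  have hsub : S.filter E ⊆ Finset.univ.filter E := Finset.filter_subset_filter _ S.subset_univ
  have key := sum_hypergeomMoment_insert (κ := (n : ℝ) / 2) hsub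
    (by rw [hE]; exact (Finset.card_filter_le _ _).trans_lt hS)
  rw [hE] at key
  rw [splitMoment, ← mul_assoc, ← key, Finset.sum_mul]
  refine Finset.sum_congr rfl fun a ha => ?_
  have ha := (Finset.mem_filter.1 ha).2
  rw [splitMoment, Finset.filter_insert, if_pos ha, Finset.filter_insert, if_neg (not_not.2 ha)]

/-- Filtering commutes with unions, so the matrix is an entrywise product of two Gram matrices, and
tensoring the Gram vectors represents it. -/
lemma exists_gram_splitMoment (hE : (Finset.univ.filter E).card = n)
    (hE' : (Finset.univ.filter fun a => ¬ E a).card = n) {t : ℕ} (ht : (2 * t : ℝ) ≤ n / 2) :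
    ∃ (Q : Finset (Finset A × Finset A)) (ψ : Finset A → Finset A × Finset A → ℝ),
      ∀ I J : Finset A, I.card ≤ t → J.card ≤ t →
        splitMoment E n (I ∪ J) = ∑ K ∈ Q, ψ I K * ψ J K := by
  have ht₀ : (0 : ℝ) ≤ t := Nat.cast_nonneg _
  obtain ⟨ψ₁, h₁⟩ := exists_gram_hypergeomMoment (U := Finset.univ.filter E) ht
    (by rw [hE]; linarith)
  obtain ⟨ψ₂, h₂⟩ := exists_gram_hypergeomMoment (U := Finset.univ.filter fun a => ¬ E a) ht
    (by rw [hE']; linarith)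
  rw [hE] at h₁
  rw [hE'] at h₂
  refine ⟨(Finset.univ.filter E).powerset ×ˢ (Finset.univ.filter fun a => ¬ E a).powerset,
    fun I K => ψ₁ (I.filter E) K.1 * ψ₂ (I.filter fun a => ¬ E a) K.2,
    fun I J hI hJ => ?_⟩
  have hsub : ∀ (q : A → Prop) [DecidablePred q] (S : Finset A),
      S.filter q ⊆ Finset.univ.filter q :=
    fun q _ S => Finset.filter_subset_filter _ S.subset_univ
  rw [splitMoment, Finset.filter_union, Finset.filter_union,
    h₁ _ (hsub _ _) _ (hsub _ _) ((Finset.card_filter_le _ _).trans hI)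
      ((Finset.card_filter_le _ _).trans hJ),
    h₂ _ (hsub _ _) _ (hsub _ _) ((Finset.card_filter_le _ _).trans hI)
      ((Finset.card_filter_le _ _).trans hJ), Finset.sum_mul_sum, Finset.sum_product]
  exact Finset.sum_congr rfl fun K _ => Finset.sum_congr rfl fun K' _ => by ring

end SplitMoment

namespace ColorfulKCenter

/-! ### Pulling moments back from clusters to points. -/

section ClusterMoment

variable {P A : Type*} [DecidableEq P] [DecidableEq A] (cl : P → A) (ctr : A → P)

/-- The value of a variable in terms of the set of opened clusters: `x p` is the indicator of the
cluster of `p` if `p` is the center of that cluster, and zero otherwise; `z p` is the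
indicator of the cluster of `p`. This predicate says that the variable is not identically zero. -/
def IsActive : P ⊕ P → Prop
  | .inl p => ctr (cl p) = p
  | .inr _ => True

open Classical in
/-- The moments on the variables of the relaxation induced by moments `Y` on the clusters. -/
noncomputable def clusterMoment (Y : Finset A → ℝ) (I : Finset (P ⊕ P)) : ℝ :=
  (if ∀ v ∈ I, IsActive cl ctr v then 1 else 0) * Y (I.image (Sum.elim cl cl))

variable {cl ctr} {Y : Finset A → ℝ} {I : Finset (P ⊕ P)}

open Classical in
lemma clusterMoment_union_inl (p : P) :
    clusterMoment cl ctr Y (I ∪ {Sum.inl p}) =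
      (if ∀ v ∈ I, IsActive cl ctr v then 1 else 0) *
        (if ctr (cl p) = p then Y (insert (cl p) (I.image (Sum.elim cl cl))) else 0) := by
  have himg : (I ∪ {Sum.inl p}).image (Sum.elim cl cl) =
      insert (cl p) (I.image (Sum.elim cl cl)) := by
    rw [Finset.union_comm, ← Finset.insert_eq, Finset.image_insert, Sum.elim_inl]
  have hact : (∀ v ∈ I ∪ {Sum.inl p}, IsActive cl ctr v) ↔
      (∀ v ∈ I, IsActive cl ctr v) ∧ ctr (cl p) = p := by
    simp only [Finset.mem_union, Finset.mem_singleton, or_imp, forall_and, forall_eq]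
    rfl
  rw [clusterMoment, himg]
  simp only [hact]
  split_ifs <;> simp_all

open Classical in
lemma clusterMoment_union_inr (p : P) :
    clusterMoment cl ctr Y (I ∪ {Sum.inr p}) =
      (if ∀ v ∈ I, IsActive cl ctr v then 1 else 0) *
        Y (insert (cl p) (I.image (Sum.elim cl cl))) := by
  have himg : (I ∪ {Sum.inr p}).image (Sum.elim cl cl) =
      insert (cl p) (I.image (Sum.elim cl cl)) := by
    rw [Finset.union_comm, ← Finset.insert_eq, Finset.image_insert, Sum.elim_inr]
  have hact : (∀ v ∈ I ∪ {Sum.inr p}, IsActive cl ctr v) ↔ ∀ v ∈ I, IsActive cl ctr v := by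
    simp only [Finset.mem_union, Finset.mem_singleton, or_imp, forall_and, forall_eq]
    exact and_iff_left trivial
  rw [clusterMoment, himg]
  simp only [hact]

end ClusterMoment

/-! ### Feasibility of the lifted solution. -/

namespace IsGapInstance

variable {P : Type*} [Fintype P] [DecidableEq P] [MetricSpace P] {I : ColorfulKCenter P} {n : ℕ}
  {D : ℝ} {C : Fin (2 * n) → Finset P}

lemma sosLift_nonempty (h : I.IsGapInstance n D C) (hD : 1 < D) {t : ℕ} (ht : 1 ≤ t)
    (htn : (t : ℝ) ≤ 1 / 4 * n) : (sosLift t (I.lp1 1)).Nonempty := by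
  classical
  obtain ⟨cl, hcl⟩ := h.exists_cluster
  choose ctr hctr hdist using h.radius_one
  have hclctr : ∀ i, cl (ctr i) = i := fun i => (hcl _ _).1 (hctr i)
  have ht2 : (2 * t : ℝ) ≤ n / 2 := by linarith
  have htn' : 4 * t ≤ n := by
    have : (4 * t : ℝ) ≤ n := by linarith
    exact_mod_cast this
  let E : Fin (2 * n) → Prop := fun i => Even (i : ℕ)
  let Y : Finset (Fin (2 * n)) → ℝ := splitMoment E n
  have hEcard : (Finset.univ.filter E).card = n := card_filter_even
  have hEcard' : (Finset.univ.filter fun i => ¬ E i).card = n := card_filter_not_even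
  obtain ⟨Q, ψ, hψ⟩ := exists_gram_splitMoment hEcard hEcard' ht2
  -- Serves three constraints: weights `(1, 1)` give `n` centers, while `(3, 1)` and `(1, 3)` give
  -- `2n` red and `2n` blue points.
  have hsum : ∀ (α β : ℝ) (S : Finset (Fin (2 * n))), S.card < n →
      ∑ i, (if E i then α else β) * Y (insert i S) = (α + β) * (n / 2) * Y S := by
    intro α β S hS
    have h₁ := sum_splitMoment_insert hEcard hS
    have h₂ := sum_splitMoment_insert hEcard' hS
    simp only [splitMoment_not] at h₂
    simp only [ite_mul]
    rw [Finset.sum_ite, ← Finset.mul_sum, ← Finset.mul_sum, h₁, h₂]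
    ring
  refine ⟨_, mem_sosLift_of_gram Q ht
    (y := clusterMoment cl ctr Y) (fun J hJ => ?_) ?_
    (fun J K => (if ∀ v ∈ J, IsActive cl ctr v then 1 else 0) * ψ (J.image (Sum.elim cl cl)) K)
    (fun J K hJ hK => ?_) fun l J hJ => ?_⟩
  · have hmem : Y (J.image (Sum.elim cl cl)) ∈ Set.Icc (0 : ℝ) 1 := by
      refine splitMoment_mem_Icc (le_trans ?_ ht2)
      exact_mod_cast Finset.card_image_le.trans hJ
    rw [clusterMoment]
    split_ifs
    · rwa [one_mul]
    · simp
  · simp [clusterMoment, Y, splitMoment, hypergeomMoment_zero_zero]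
  · have hact : (∀ v ∈ J ∪ K, IsActive cl ctr v) ↔
        (∀ v ∈ J, IsActive cl ctr v) ∧ ∀ v ∈ K, IsActive cl ctr v := by
      simp only [Finset.mem_union, or_imp, forall_and]
    rw [clusterMoment, Finset.image_union,
      show Y (J.image _ ∪ K.image _) = _ from
        hψ _ _ (Finset.card_image_le.trans hJ) (Finset.card_image_le.trans hK), Finset.mul_sum]
    refine Finset.sum_congr rfl fun L _ => ?_
    simp only [hact]
    split_ifs <;> simp_all
  · have hS : (J.image (Sum.elim cl cl)).card < n :=
      lt_of_le_of_lt Finset.card_image_le (by omega)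
    have hext : ∀ v : P ⊕ P,
        extendByZero (fun K : SubsetsUpTo (P ⊕ P) (2 * t) => clusterMoment cl ctr Y K.1)
          (J ∪ {v}) = clusterMoment cl ctr Y (J ∪ {v}) := fun v =>
      extendByZero_of_card_le _ ((Finset.card_union_le _ _).trans
        (by rw [Finset.card_singleton]; omega))
    have hext₀ : extendByZero
        (fun K : SubsetsUpTo (P ⊕ P) (2 * t) => clusterMoment cl ctr Y K.1) (J ∪ ∅) =
          clusterMoment cl ctr Y J := by
      rw [Finset.union_empty, extendByZero_of_card_le _ (by omega)]
    cases l with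
    | cover j =>
      simp only [lp1, shiftOp_sub, shiftOp_sum, shiftOp_single, one_mul, hext,
        clusterMoment_union_inl, clusterMoment_union_inr]
      -- Only the center of the cluster of `j` contributes: all other centers are at distance at
      -- least `D > 1` from `j`.
      rw [← Finset.mul_sum, ← mul_sub, Finset.sum_eq_single (ctr (cl j)), hclctr, if_pos rfl,
        sub_self, mul_zero]
      · intro p hp hne
        rw [if_neg]
        intro hpc
        have hcl_ne : cl p ≠ cl j := fun he => hne (by rw [← he, hpc])
        have := h.far_apart _ _ hcl_ne p ((hcl _ _).2 rfl) j ((hcl _ _).2 rfl)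
        linarith [mem_pointBall.1 hp]
      · intro hnot
        refine absurd (mem_pointBall.2 ?_) hnot
        rw [dist_comm]
        exact hdist _ _ ((hcl _ _).2 rfl)
    | centers =>
      simp only [lp1, shiftOp_sub, shiftOp_sum, shiftOp_single, one_mul, hext, hext₀,
        clusterMoment_union_inl, h.k_eq]
      have hall : ∑ p : P, (if ctr (cl p) = p then Y (insert (cl p) (J.image (Sum.elim cl cl)))
          else 0) = ∑ i, Y (insert i (J.image (Sum.elim cl cl))) := by
        rw [← Finset.sum_filter]
        refine Finset.sum_nbij' cl ctr (fun _ _ => Finset.mem_univ _) (fun i _ => ?_)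
          (fun p hp => (Finset.mem_filter.1 hp).2) (fun i _ => hclctr i) fun _ _ => rfl
        simp [hclctr]
      have := hsum 1 1 _ hS
      simp only [ite_self, one_mul] at this
      rw [← Finset.mul_sum, hall, this, clusterMoment]
      ring
    | redCoverage =>
      simp only [lp1, shiftOp_sub, shiftOp_sum, shiftOp_single, one_mul, hext, hext₀,
        clusterMoment_union_inr, h.r_eq]
      rw [← Finset.mul_sum,
        sum_eq_sum_clusters hcl I.red fun i => Y (insert i (J.image (Sum.elim cl cl)))]
      have := hsum 3 1 _ hS
      simp only [h.card_red]
      push_cast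
      rw [this, clusterMoment]
      ring
    | blueCoverage =>
      simp only [lp1, shiftOp_sub, shiftOp_sum, shiftOp_single, one_mul, hext, hext₀,
        clusterMoment_union_inr, h.b_eq]
      rw [← Finset.mul_sum,
        sum_eq_sum_clusters hcl I.blue fun i => Y (insert i (J.image (Sum.elim cl cl)))]
      have := hsum 1 3 _ hS
      simp only [h.card_blue]
      push_cast
      rw [this, clusterMoment]
      ring

end IsGapInstance

end ColorfulKCenter

theorem mainTheorem4 :
    ∃ c : ℝ, 0 < c ∧ ∀ n : ℕ, Odd n → ∀ D : ℝ, 1 < D →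
      (∃ (P : Type) (_ : Fintype P) (_ : DecidableEq P) (_ : MetricSpace P)
        (I : ColorfulKCenter P) (C : Fin (2 * n) → Finset P), I.IsGapInstance n D C) ∧
      ∀ (P : Type) [Fintype P] [DecidableEq P] [MetricSpace P]
        (I : ColorfulKCenter P) (C : Fin (2 * n) → Finset P), I.IsGapInstance n D C →
        (∃ ρ : ℝ, I.IsOptimalRadius ρ ∧ D ≤ ρ) ∧
        ∀ t : ℕ, 1 ≤ t → (t : ℝ) ≤ c * n → (sosLift t (I.lp1 1)).Nonempty := by
  -- The constant `1/4` is the condition `2t ≤ κ` at `κ = n/2`.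
  refine ⟨1 / 4, by norm_num, fun n hn D hD =>
    ⟨ColorfulKCenter.exists_isGapInstance n hD, fun P _ _ _ I C h => ?_⟩⟩
  exact ⟨h.exists_isOptimalRadius_ge hn, fun t ht htn => h.sosLift_nonempty hD ht htn⟩
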